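/- Let $(M,g)$ be a $3$-dimensional smooth Riemannian manifold with Levi-Civita connection $\nabla$, Ricci tensor $S$ and scalar curvature $r$. Let $\phi$ be a smooth $(1,1)$-tensor field, $\xi$ a smooth vector field and $\eta$ a smooth $1$-form on $M$ such that, for all vector fields $X,Y$, $$\phi^2=-I+\eta\otimes\xi,\quad \eta(\xi)=1,\quad \eta(X)=g(X,\xi),\quad g(\phi X,\phi Y)=g(X,Y)-\eta(X)\eta(Y),\quad g(X,\phi Y)+g(Y,\phi X)=0 .$$ Let $\alpha,\beta$ be smooth functions on $M$ and suppose that $(M,g,\phi,\xi,\eta)$ is trans-Sasakian of type $(\alpha,\beta)$, i.e. for all vector fields $X,Y$, $$(\nabla_X\phi)Y=\alpha\,[g(X,Y)\xi-\eta(Y)X]+\beta\,[g(\phi X,Y)\xi-\eta(Y)\phi X].$$ Let $\lambda,\mu\in\mathbb{R}$ be such that $(g,\xi,\lambda,\mu)$ is an $\eta$-Einstein soliton on $M$, i.e. $$\mathcal{L}_\xi g+2S+(2\lambda-r)g+2\mu\,\eta\otimes\eta=0,$$ and suppose that the Ricci tensor is cyclic parallel, i.e. for all vector fields $X,Y,Z$,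 $$(\nabla_XS)(Y,Z)+(\nabla_YS)(Z,X)+(\nabla_ZS)(X,Y)=0 .$$ Suppose finally that $\beta$ does not vanish identically on any connected component of $M$. Then $\beta$ is constant and equal to $\mu$, the manifold is Einstein (that is, $S=c\,g$ for a constant $c$), and its scalar curvature is the constant $r=6\lambda+6\beta$. -/

import Mathlib

open Bundle FiberBundle VectorField
open scoped Manifold ContDiff

noncomputable section

namespace RiemGeom

variable {E : Type*} [NormedAddCommGroup E] [NormedSpace ℝ E] [FiniteDimensional ℝ E]
  [CompleteSpace E]
  {H : Type*} [TopologicalSpace H] {I : ModelWithCorners ℝ E H}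
  {M : Type*} [TopologicalSpace M] [ChartedSpace H M] [IsManifold I ∞ M]
  [RiemannianBundle (fun x : M ↦ TangentSpace I x)]

/-- The Koszul expression
`X g(Y,Z) + Y g(Z,X) - Z g(X,Y) - g(X,[Y,Z]) + g(Y,[Z,X]) + g(Z,[X,Y])`. -/
def koszul (X Y Z : Π x : M, TangentSpace I x) (x : M) : ℝ :=
  mvfderiv I (fun y ↦ inner ℝ (Y y) (Z y)) x (X x)
    + mvfderiv I (fun y ↦ inner ℝ (Z y) (X y)) x (Y x)
    - mvfderiv I (fun y ↦ inner ℝ (X y) (Y y)) x (Z x)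
    - inner ℝ (X x) (mlieBracket I Y Z x)
    + inner ℝ (Y x) (mlieBracket I Z X x)
    + inner ℝ (Z x) (mlieBracket I X Y x)

variable [IsContMDiffRiemannianBundle I ∞ E (fun x : M ↦ TangentSpace I x)]
  {X X' Y Y' Z Z' : Π x : M, TangentSpace I x} {f : M → ℝ} {x : M}

lemma inner_mdiff (hX : MDiffAt (T% X) x) (hY : MDiffAt (T% Y) x) :
    MDiffAt (fun y ↦ inner ℝ (X y) (Y y)) x := by
  have : IsContMDiffRiemannianBundle I 1 E (fun x : M ↦ TangentSpace I x) :=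
    IsContMDiffRiemannianBundle.of_le (n := ∞) (by norm_cast)
  exact MDifferentiableAt.inner_bundle (F := E) (E := fun x : M ↦ TangentSpace I x) hX hY

lemma koszul_tensorial_right (hX : MDiffAt (T% X) x) (hY : MDiffAt (T% Y) x) :
    TensorialAt I E (fun Z ↦ koszul X Y Z x) x where
  smul {f Z} hf hZ := by
    simp [koszul, inner_smul_left, inner_smul_right, mvfderiv_fun_mul hf (inner_mdiff hY hZ),
      mvfderiv_fun_mul hf (inner_mdiff hZ hX), mlieBracket_smul_left hf hZ,
      mlieBracket_smul_right hf hZ, inner_add_right]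
    rw [real_inner_comm (X x) (Z x)]
    ring
  add {Z Z'} hZ hZ' := by
    simp [koszul, inner_add_left, inner_add_right,
      mvfderiv_fun_add (inner_mdiff hY hZ) (inner_mdiff hY hZ'),
      mvfderiv_fun_add (inner_mdiff hZ hX) (inner_mdiff hZ' hX), mlieBracket_add_left hZ hZ',
      mlieBracket_add_right hZ hZ']
    ring

lemma koszul_tensorial_left (hY : MDiffAt (T% Y) x) (hZ : MDiffAt (T% Z) x) :
    TensorialAt I E (fun X ↦ koszul X Y Z x) x where
  smul {f X} hf hX := by
    simp [koszul, inner_smul_left, inner_smul_right, mvfderiv_fun_mul hf (inner_mdiff hZ hX),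
      mvfderiv_fun_mul hf (inner_mdiff hX hY), mlieBracket_smul_left hf hX,
      mlieBracket_smul_right hf hX, inner_add_right]
    rw [real_inner_comm (X x) (Y x), real_inner_comm (X x) (Z x)]
    ring
  add {X X'} hX hX' := by
    simp [koszul, inner_add_left, inner_add_right,
      mvfderiv_fun_add (inner_mdiff hZ hX) (inner_mdiff hZ hX'),
      mvfderiv_fun_add (inner_mdiff hX hY) (inner_mdiff hX' hY), mlieBracket_add_left hX hX',
      mlieBracket_add_right hX hX']
    ring

lemma koszul_smul_middle (hf : MDiffAt f x) (hX : MDiffAt (T% X) x) (hY : MDiffAt (T% Y) x)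
    (hZ : MDiffAt (T% Z) x) :
    koszul X (f • Y) Z x
      = f x * koszul X Y Z x + 2 * (mvfderiv I f x (X x) * inner ℝ (Y x) (Z x)) := by
  simp [koszul, inner_smul_left, inner_smul_right, mvfderiv_fun_mul hf (inner_mdiff hY hZ),
    mvfderiv_fun_mul hf (inner_mdiff hX hY), mlieBracket_smul_left hf hY,
    mlieBracket_smul_right hf hY, inner_add_right]
  rw [real_inner_comm (Y x) (X x), real_inner_comm (Y x) (Z x)]
  ring

lemma koszul_add_middle (hX : MDiffAt (T% X) x) (hY : MDiffAt (T% Y) x)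
    (hY' : MDiffAt (T% Y') x) (hZ : MDiffAt (T% Z) x) :
    koszul X (Y + Y') Z x = koszul X Y Z x + koszul X Y' Z x := by
  simp [koszul, inner_add_left, inner_add_right,
    mvfderiv_fun_add (inner_mdiff hY hZ) (inner_mdiff hY' hZ),
    mvfderiv_fun_add (inner_mdiff hX hY) (inner_mdiff hX hY'), mlieBracket_add_left hY hY',
    mlieBracket_add_right hY hY']
  ring

/-- For a vector field `Y` differentiable at `x`, the bilinear form
`(X, Z) ↦ koszul X Y Z` on the tangent space at `x` (and `0` otherwise). -/
def koszulForm (Y : Π x : M, TangentSpace I x) (x : M) :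
    TangentSpace I x →L[ℝ] TangentSpace I x →L[ℝ] ℝ :=
  open Classical in
  if hY : MDiffAt (T% Y) x then
    TensorialAt.mkHom₂ (fun X Z ↦ koszul X Y Z x) x
      (fun _ hZ ↦ koszul_tensorial_left hY hZ) (fun _ hX ↦ koszul_tensorial_right hX hY)
  else 0

lemma koszulForm_apply (hX : MDiffAt (T% X) x) (hY : MDiffAt (T% Y) x)
    (hZ : MDiffAt (T% Z) x) : koszulForm Y x (X x) (Z x) = koszul X Y Z x := by
  rw [koszulForm, dif_pos hY, TensorialAt.mkHom₂_apply _ _ hX hZ]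

instance instFiniteDimensionalTangent (x : M) : FiniteDimensional ℝ (TangentSpace I x) :=
  inferInstanceAs (FiniteDimensional ℝ E)

/-- An orthonormal basis of the tangent space at `x`. -/
def onb (x : M) : OrthonormalBasis (Fin (Module.finrank ℝ (TangentSpace I x))) ℝ
    (TangentSpace I x) :=
  stdOrthonormalBasis ℝ (TangentSpace I x)

/-- `u ↦ ∇_u Y`, determined by `2 g(∇_u Y, w) = koszulForm Y x u w` for all `w`. -/
def leviCivitaAux (Y : Π x : M, TangentSpace I x) (x : M) :
    TangentSpace I x →L[ℝ] TangentSpace I x :=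
  (1 / 2 : ℝ) • ∑ i, ((koszulForm Y x).flip (onb x i)).smulRight (onb x i)

lemma inner_leviCivitaAux (Y : Π x : M, TangentSpace I x) (x : M) (u w : TangentSpace I x) :
    2 * inner ℝ (leviCivitaAux Y x u) w = koszulForm Y x u w := by
  conv_rhs => rw [← (onb x).sum_repr' w]
  simp [leviCivitaAux, inner_smul_left, sum_inner, mul_comm]

lemma leviCivitaAux_ext {u : TangentSpace I x} {v : TangentSpace I x}
    (h : ∀ Z : Π x : M, TangentSpace I x, MDiffAt (T% Z) x →
      koszulForm Y x u (Z x) = 2 * inner ℝ v (Z x)) : leviCivitaAux Y x u = v := by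
  refine ext_inner_right ℝ fun w ↦ ?_
  have := h (extend E w) (mdifferentiableAt_extend ..)
  rw [extend_apply_self, ← inner_leviCivitaAux] at this
  linarith

variable (I M) in
/-- The Levi-Civita connection: `leviCivita I M Y x u` is `∇_u Y` at `x`. -/
def leviCivita : CovariantDerivative I E (fun x : M ↦ TangentSpace I x) where
  toFun := leviCivitaAux
  isCovariantDerivativeOnUniv :=
    { add := by
        intro Y Y' x hY hY' _
        ext1 u
        refine leviCivitaAux_ext fun Z hZ ↦ ?_
        have hu : MDiffAt (T% (extend E u)) x := mdifferentiableAt_extend ..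
        have hs := koszulForm_apply hu (mdifferentiableAt_add_section hY hY') hZ
        have h1 := koszulForm_apply hu hY hZ
        have h2 := koszulForm_apply hu hY' hZ
        rw [extend_apply_self] at hs h1 h2
        rw [add_apply, inner_add_left, mul_add, inner_leviCivitaAux,
          inner_leviCivitaAux, h1, h2, hs, koszul_add_middle hu hY hY' hZ]
      leibniz := by
        intro Y f x hY hf _
        ext1 u
        refine leviCivitaAux_ext fun Z hZ ↦ ?_
        have hu : MDiffAt (T% (extend E u)) x := mdifferentiableAt_extend ..
        have hs := koszulForm_apply hu (hf.smul_section hY) hZ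
        have h1 := koszulForm_apply hu hY hZ
        rw [extend_apply_self] at hs h1
        have h3 := inner_leviCivitaAux Y x u (Z x)
        rw [hs, koszul_smul_middle hf hu hY hZ, extend_apply_self, ← h1, ← h3]
        simp [inner_add_left, inner_smul_left]
        ring }

lemma koszul_formula (hX : MDiffAt (T% X) x) (hY : MDiffAt (T% Y) x) (hZ : MDiffAt (T% Z) x) :
    2 * inner ℝ (leviCivita I M Y x (X x)) (Z x) = koszul X Y Z x :=
  (inner_leviCivitaAux ..).trans (koszulForm_apply hX hY hZ)

/-- The Levi-Civita connection is compatible with the metric. -/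
lemma leviCivita_metric (hX : MDiffAt (T% X) x) (hY : MDiffAt (T% Y) x) (hZ : MDiffAt (T% Z) x) :
    mvfderiv I (fun y ↦ inner ℝ (Y y) (Z y)) x (X x)
      = inner ℝ (leviCivita I M Y x (X x)) (Z x) + inner ℝ (Y x) (leviCivita I M Z x (X x)) := by
  have h1 := koszul_formula hX hY hZ
  have h2 := koszul_formula hX hZ hY
  rw [real_inner_comm] at h2
  have e (A B : Π x : M, TangentSpace I x) :
      (fun y ↦ inner ℝ (A y) (B y)) = fun y ↦ inner ℝ (B y) (A y) :=
    funext fun y ↦ real_inner_comm _ _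
  simp only [koszul, e Z Y, e X Z, e X Y, mlieBracket_swap_apply (V := Z) (W := Y),
    mlieBracket_swap_apply (V := X) (W := Z), mlieBracket_swap_apply (V := Y) (W := X),
    inner_neg_right] at h1 h2
  linarith

/-- The Levi-Civita connection is torsion free. -/
lemma leviCivita_torsionFree (hX : MDiffAt (T% X) x) (hY : MDiffAt (T% Y) x) :
    leviCivita I M Y x (X x) - leviCivita I M X x (Y x) = mlieBracket I X Y x := by
  refine ext_inner_right ℝ fun w ↦ ?_
  have hw : MDiffAt (T% (extend E w)) x := mdifferentiableAt_extend ..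
  have h1 := koszul_formula hX hY hw
  have h2 := koszul_formula hY hX hw
  rw [inner_sub_left]
  have e (A B : Π x : M, TangentSpace I x) :
      (fun y ↦ inner ℝ (A y) (B y)) = fun y ↦ inner ℝ (B y) (A y) :=
    funext fun y ↦ real_inner_comm _ _
  rw [real_inner_comm w (mlieBracket I X Y x)]
  simp only [koszul, extend_apply_self, e (extend E w) Y, e X (extend E w), e Y X,
    mlieBracket_swap_apply (V := extend E w) (W := Y),
    mlieBracket_swap_apply (V := X) (W := extend E w), mlieBracket_swap_apply (V := Y) (W := X),
    inner_neg_right] at h1 h2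
  linarith

variable (I)

/-- `R(X,Y)Z = ∇_X ∇_Y Z - ∇_Y ∇_X Z - ∇_{[X,Y]} Z` at `x`. -/
def curvature (X Y Z : Π x : M, TangentSpace I x) (x : M) : TangentSpace I x :=
  leviCivita I M (fun y ↦ leviCivita I M Z y (Y y)) x (X x)
    - leviCivita I M (fun y ↦ leviCivita I M Z y (X y)) x (Y x)
    - leviCivita I M Z x (mlieBracket I X Y x)

/-- The Ricci tensor `S(v,w) = tr (u ↦ R(u,v)w)` at `x`. The curvature is evaluated on tangent
vectors through the local extensions `extend E u` (smooth near `x`, with value `u` at `x`), and the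
trace is computed in an orthonormal basis. -/
def ricci (x : M) (v w : TangentSpace I x) : ℝ :=
  ∑ i, inner ℝ (curvature I (extend E (onb x i)) (extend E v) (extend E w) x) (onb x i)

/-- The scalar curvature, i.e. the trace of the Ricci tensor with respect to the metric. -/
def scalarCurvature (x : M) : ℝ := ∑ i, ricci I x (onb x i) (onb x i)

/-- `(L_ξ g)(X,Y) = ξ g(X,Y) - g([ξ,X],Y) - g(X,[ξ,Y])` at `x`. -/
def lieDerivMetric (ξ X Y : Π x : M, TangentSpace I x) (x : M) : ℝ :=
  mvfderiv I (fun y ↦ inner ℝ (X y) (Y y)) x (ξ x)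
    - inner ℝ (mlieBracket I ξ X x) (Y x) - inner ℝ (X x) (mlieBracket I ξ Y x)

/-- `(∇_X φ)(Y) = ∇_X (φ Y) - φ (∇_X Y)` at `x`, for a `(1,1)`-tensor field `φ`. -/
def covDerivEnd (φ : Π x : M, TangentSpace I x →L[ℝ] TangentSpace I x)
    (X Y : Π x : M, TangentSpace I x) (x : M) : TangentSpace I x :=
  leviCivita I M (fun y ↦ φ y (Y y)) x (X x) - φ x (leviCivita I M Y x (X x))

/-- `(∇_X B)(Y,Z) = X B(Y,Z) - B(∇_X Y,Z) - B(Y,∇_X Z)` at `x`, for a `(0,2)`-tensor field `B`. -/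
def covDerivForm (B : Π x : M, TangentSpace I x → TangentSpace I x → ℝ)
    (X Y Z : Π x : M, TangentSpace I x) (x : M) : ℝ :=
  mvfderiv I (fun y ↦ B y (Y y) (Z y)) x (X x)
    - B x (leviCivita I M Y x (X x)) (Z x) - B x (Y x) (leviCivita I M Z x (X x))

/-- `(φ, ξ, η, g)` is an almost contact metric structure; `g` is the Riemannian metric of `M`. -/
structure IsAlmostContactMetric (φ : Π x : M, TangentSpace I x →L[ℝ] TangentSpace I x)
    (ξ : Π x : M, TangentSpace I x) (η : Π x : M, TangentSpace I x →L[ℝ] ℝ) : Prop where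
  smooth_phi : ContMDiff I (I.prod 𝓘(ℝ, E →L[ℝ] E)) ∞
    (fun x ↦ TotalSpace.mk' (E →L[ℝ] E) (E := fun x : M ↦ TangentSpace I x →L[ℝ] TangentSpace I x)
      x (φ x))
  smooth_xi : ContMDiff I I.tangent ∞ (fun x ↦ (ξ x : TangentBundle I M))
  smooth_eta : ContMDiff I (I.prod 𝓘(ℝ, E →L[ℝ] ℝ)) ∞
    (fun x ↦ TotalSpace.mk' (E →L[ℝ] ℝ) (E := fun x : M ↦ TangentSpace I x →L[ℝ] ℝ) x (η x))
  phi_phi : ∀ (x : M) (u : TangentSpace I x), φ x (φ x u) = -u + η x u • ξ x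
  eta_xi : ∀ x : M, η x (ξ x) = 1
  eta_eq : ∀ (x : M) (u : TangentSpace I x), η x u = inner ℝ u (ξ x)
  inner_phi_phi : ∀ (x : M) (u v : TangentSpace I x),
    inner ℝ (φ x u) (φ x v) = inner ℝ u v - η x u * η x v
  phi_skew : ∀ (x : M) (u v : TangentSpace I x), inner ℝ u (φ x v) + inner ℝ v (φ x u) = 0

/-- `(M, g, φ, ξ, η)` is a trans-Sasakian manifold of type `(α, β)`. -/
structure IsTransSasakian (φ : Π x : M, TangentSpace I x →L[ℝ] TangentSpace I x)
    (ξ : Π x : M, TangentSpace I x) (η : Π x : M, TangentSpace I x →L[ℝ] ℝ) (α β : M → ℝ) : Prop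
    extends IsAlmostContactMetric I φ ξ η where
  smooth_alpha : ContMDiff I 𝓘(ℝ, ℝ) ∞ α
  smooth_beta : ContMDiff I 𝓘(ℝ, ℝ) ∞ β
  covDeriv_phi : ∀ (x : M) (X Y : Π x : M, TangentSpace I x),
    CMDiffAt ∞ (T% X) x → CMDiffAt ∞ (T% Y) x →
    covDerivEnd I φ X Y x
      = α x • ((inner ℝ (X x) (Y x) : ℝ) • ξ x - η x (Y x) • X x)
        + β x • ((inner ℝ (φ x (X x)) (Y x) : ℝ) • ξ x - η x (Y x) • φ x (X x))

/-- `(g, ξ, lam, mu)` is an `η`-Einstein soliton: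
`L_ξ g + 2 S + (2 lam - r) g + 2 mu η ⊗ η = 0`. -/
def IsEtaEinsteinSoliton (ξ : Π x : M, TangentSpace I x) (η : Π x : M, TangentSpace I x →L[ℝ] ℝ)
    (lam mu : ℝ) : Prop :=
  ∀ (x : M) (X Y : Π x : M, TangentSpace I x), CMDiffAt ∞ (T% X) x → CMDiffAt ∞ (T% Y) x →
    lieDerivMetric I ξ X Y x + 2 * ricci I x (X x) (Y x)
      + (2 * lam - scalarCurvature I x) * inner ℝ (X x) (Y x)
      + 2 * mu * (η x (X x) * η x (Y x)) = 0

variable (M)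

/-- The Ricci tensor `S` is cyclic parallel:
`(∇_X S)(Y,Z) + (∇_Y S)(Z,X) + (∇_Z S)(X,Y) = 0`. -/
def HasCyclicParallelRicci : Prop :=
  ∀ (x : M) (X Y Z : Π x : M, TangentSpace I x),
    CMDiffAt ∞ (T% X) x → CMDiffAt ∞ (T% Y) x → CMDiffAt ∞ (T% Z) x →
    covDerivForm I (ricci I) X Y Z x + covDerivForm I (ricci I) Y Z X x
      + covDerivForm I (ricci I) Z X Y x = 0

/-- `M` is an Einstein manifold: `S = c g` for a constant `c`. -/
def IsEinstein : Prop :=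
  ∃ c : ℝ, ∀ (x : M) (u v : TangentSpace I x), ricci I x u v = c * inner ℝ u v

end RiemGeom

end

/-! The curvature is never computed: the soliton equation determines `S` algebraically. The
structure equation gives `∇ξ` (`leviCivita_xi`), hence `L_ξ g = 2β(g - η ⊗ η)`. Taking the trace in
dimension 3 then gives `S = (2λ + μ + β) g + (β - μ) η ⊗ η` (`ricci_eq`).

The diagonal of the cyclic condition becomes a pointwise identity in `dβ` and `β(β - μ)`
(`mvfderiv_beta_identity`). Testing it on `ξ` and on vectors orthogonal to `ξ` gives `dβ = 0`;
testing it on mixed vectors gives `β(β - μ) = 0`. So `β` is locally constant with values in `{0,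
μ}`, and since it is not identically zero on any component, `β = μ`. The `η ⊗ η` term of `S` then
disappears. -/

open Bundle FiberBundle VectorField
open scoped Manifold ContDiff

noncomputable section

namespace RiemGeom

/-! ### Functions with vanishing differential -/

section LocallyConstant

variable {E : Type*} [NormedAddCommGroup E] [NormedSpace ℝ E]
  {H : Type*} [TopologicalSpace H] {I : ModelWithCorners ℝ E H} [I.Boundaryless]
  {M : Type*} [TopologicalSpace M] [ChartedSpace H M] [IsManifold I 1 M]

/-- A differentiable function on a boundaryless manifold whose differential vanishes everywhere is
locally constant. -/
lemma isLocallyConstant_of_mvfderiv_eq_zero {f : M → ℝ} (hf : ∀ x, MDiffAt f x)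
    (h : ∀ x, mvfderiv I f x = 0) : IsLocallyConstant f := by
  rw [IsLocallyConstant.iff_eventually_eq]
  intro x
  set e := extChartAt I x
  have hopen : IsOpen e.target := isOpen_extChartAt_target x
  have hd : ∀ z ∈ e.target, HasFDerivAt (f ∘ e.symm) (0 : E →L[ℝ] ℝ) z := by
    intro z hz
    have h1 : MDifferentiableAt 𝓘(ℝ, E) I e.symm z :=
      ((contMDiffOn_extChartAt_symm x).contMDiffAt (hopen.mem_nhds hz)).mdifferentiableAt
        one_ne_zero
    have h0 : mfderiv I 𝓘(ℝ, ℝ) f (e.symm z) = 0 := by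
      ext v
      exact DFunLike.congr_fun (h (e.symm z)) v
    have h2 := (hf (e.symm z)).hasMFDerivAt.comp z h1.hasMFDerivAt
    rw [h0] at h2
    exact h2.hasFDerivAt.congr_fderiv (ContinuousLinearMap.ext fun _ ↦ rfl)
  obtain ⟨r, hr, hball⟩ := Metric.isOpen_iff.1 hopen (e x) (mem_extChartAt_target x)
  -- The chart target need not be convex, so the mean value argument is run on a ball inside it.
  have hconst : ∀ z ∈ Metric.ball (e x) r, f (e.symm z) = f x := by
    intro z hz
    have := (convex_ball (e x) r).is_const_of_fderivWithin_eq_zero (𝕜 := ℝ) (f := f ∘ e.symm)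
      (fun w hw ↦ (hd w (hball hw)).differentiableAt.differentiableWithinAt)
      (fun w hw ↦ by
        rw [fderivWithin_of_isOpen Metric.isOpen_ball hw, (hd w (hball hw)).fderiv])
      hz (Metric.mem_ball_self hr)
    simpa [e] using this
  have hc : Filter.Tendsto e (nhds x) (nhds (e x)) := continuousAt_extChartAt x
  filter_upwards [hc (Metric.ball_mem_nhds _ hr), extChartAt_source_mem_nhds (I := I) x]
    with y hy hys
  have := hconst (e y) hy
  rwa [e.left_inv hys] at this

end LocallyConstant

variable {E : Type*} [NormedAddCommGroup E] [NormedSpace ℝ E] [FiniteDimensional ℝ E]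
  [CompleteSpace E]
  {H : Type*} [TopologicalSpace H] {I : ModelWithCorners ℝ E H}
  {M : Type*} [TopologicalSpace M] [ChartedSpace H M] [IsManifold I ∞ M]
  [RiemannianBundle (fun x : M ↦ TangentSpace I x)]
  [IsContMDiffRiemannianBundle I ∞ E (fun x : M ↦ TangentSpace I x)]
  {φ : Π x : M, TangentSpace I x →L[ℝ] TangentSpace I x}
  {ξ : Π x : M, TangentSpace I x} {η : Π x : M, TangentSpace I x →L[ℝ] ℝ}
  {α β : M → ℝ} {lam mu : ℝ} {x : M}

lemma contMDiffAt_extend_tangent (u : TangentSpace I x) : CMDiffAt ∞ (T% (extend E u)) x :=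
  contMDiffAt_extend ..

/-! ### Structure identities and the derivative of `ξ` -/

namespace IsAlmostContactMetric

variable (h : IsAlmostContactMetric I φ ξ η)

include h

lemma mdiff_xi (x : M) : MDiffAt (T% ξ) x :=
  (h.smooth_xi x).mdifferentiableAt (by simp)

lemma inner_xi_xi (x : M) : inner ℝ (ξ x) (ξ x) = 1 := by
  rw [← h.eta_eq, h.eta_xi]

/-- `|φξ|² = |ξ|² - η(ξ)² = 0`. -/
lemma phi_xi (x : M) : φ x (ξ x) = 0 := by
  have := h.inner_phi_phi x (ξ x) (ξ x)
  rw [h.inner_xi_xi, h.eta_xi] at this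
  exact inner_self_eq_zero.1 (this.trans (by norm_num))

lemma inner_leviCivita_xi_xi (u : TangentSpace I x) :
    inner ℝ (leviCivita I M ξ x u) (ξ x) = 0 := by
  have hu : MDiffAt (T% (extend E u)) x := mdifferentiableAt_extend ..
  have := leviCivita_metric hu (h.mdiff_xi x) (h.mdiff_xi x)
  rw [funext h.inner_xi_xi, mvfderiv_const, extend_apply_self,
    real_inner_comm (leviCivita I M ξ x u) (ξ x)] at this
  have h0 : (0 : ℝ) = inner ℝ (leviCivita I M ξ x u) (ξ x)
      + inner ℝ (leviCivita I M ξ x u) (ξ x) := this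
  linarith

end IsAlmostContactMetric

/-- `∇_u ξ = -α φ u + β (u - η(u) ξ)` on a trans-Sasakian manifold. -/
lemma IsTransSasakian.leviCivita_xi (h : IsTransSasakian I φ ξ η α β) (u : TangentSpace I x) :
    leviCivita I M ξ x u = -α x • φ x u + β x • (u - η x u • ξ x) := by
  have hc := h.toIsAlmostContactMetric
  have key := h.covDeriv_phi x (extend E u) ξ (contMDiffAt_extend_tangent u) (h.smooth_xi x)
  have hz : (fun y ↦ φ y (ξ y)) = 0 := funext h.phi_xi
  rw [covDerivEnd, hz, CovariantDerivative.zero, extend_apply_self, hc.eta_xi] at key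
  have e1 : inner ℝ (φ x u) (ξ x) = 0 := by
    have := hc.phi_skew x u (ξ x)
    rw [hc.phi_xi, inner_zero_right, real_inner_comm] at this
    linarith
  rw [e1, ← hc.eta_eq] at key
  -- With `Y = ξ` the structure equation only gives `φ(∇_u ξ)`. Since `∇_u ξ ⊥ ξ`, where `φ² = -1`,
  -- applying `φ` once more recovers `∇_u ξ`.
  have key2 := congrArg (φ x) key
  have e2 : η x (leviCivita I M ξ x u) = 0 := by
    rw [hc.eta_eq, hc.inner_leviCivita_xi_xi]
  simp only [Pi.zero_apply, zero_apply, zero_sub, map_neg, hc.phi_phi, e2, map_add, map_smul,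
    map_sub, hc.phi_xi] at key2
  simp only [zero_smul, add_zero, neg_neg, one_smul, smul_zero] at key2
  rw [key2]
  module

/-! ### The Ricci tensor of the soliton -/

lemma lieDerivMetric_eq {X Y : Π x : M, TangentSpace I x} (hξ : MDiffAt (T% ξ) x)
    (hX : MDiffAt (T% X) x) (hY : MDiffAt (T% Y) x) :
    lieDerivMetric I ξ X Y x
      = inner ℝ (leviCivita I M ξ x (X x)) (Y x) + inner ℝ (X x) (leviCivita I M ξ x (Y x)) := by
  rw [lieDerivMetric, leviCivita_metric hξ hX hY, ← leviCivita_torsionFree hξ hX,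
    ← leviCivita_torsionFree hξ hY, inner_sub_left, inner_sub_right]
  ring

/-- The `α φ` part of `∇ξ` is skew, so it drops out of the symmetric form `L_ξ g`. -/
lemma IsTransSasakian.ricci_eq_of_soliton (h : IsTransSasakian I φ ξ η α β)
    (hsol : IsEtaEinsteinSoliton I ξ η lam mu) (u v : TangentSpace I x) :
    ricci I x u v = (scalarCurvature I x / 2 - lam - β x) * inner ℝ u v
      + (β x - mu) * (η x u * η x v) := by
  have hc := h.toIsAlmostContactMetric
  have hu := contMDiffAt_extend_tangent (E := E) u
  have hv := contMDiffAt_extend_tangent (E := E) v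
  have key := hsol x _ _ hu hv
  rw [lieDerivMetric_eq (hc.mdiff_xi x) (mdifferentiableAt_extend ..)
    (mdifferentiableAt_extend ..)] at key
  simp only [extend_apply_self, h.leviCivita_xi] at key
  have hs := hc.phi_skew x u v
  have h1 := hc.eta_eq x u
  have h2 := hc.eta_eq x v
  simp only [inner_add_left, inner_add_right, inner_smul_left, inner_smul_right, inner_sub_left,
    inner_sub_right, real_inner_comm v (φ x u), real_inner_comm v (ξ x), ← h1, ← h2,
    conj_trivial] at key
  linear_combination key / 2 + α x / 2 * hs

lemma sum_inner_onb_self (hE : Module.finrank ℝ E = 3) (x : M) :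
    ∑ i, inner ℝ (onb (I := I) x i) (onb x i) = 3 := by
  have : Module.finrank ℝ (TangentSpace I x) = 3 := hE
  simp [this]

/-- Parseval's identity for the unit vector `ξ`. -/
lemma IsAlmostContactMetric.sum_eta_onb_sq (h : IsAlmostContactMetric I φ ξ η) (x : M) :
    ∑ i, η x (onb x i) * η x (onb x i) = 1 := by
  rw [← h.inner_xi_xi x, ← (onb x).sum_inner_mul_inner]
  refine Finset.sum_congr rfl fun i _ ↦ ?_
  rw [h.eta_eq, real_inner_comm]

variable (hE : Module.finrank ℝ E = 3)

include hE

/-- The trace reads `r = 3(r/2 - λ - β) + (β - μ)`, which is solved for `r`. -/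
lemma IsTransSasakian.scalarCurvature_eq_of_soliton (h : IsTransSasakian I φ ξ η α β)
    (hsol : IsEtaEinsteinSoliton I ξ η lam mu) (x : M) :
    scalarCurvature I x = 6 * lam + 4 * β x + 2 * mu := by
  have key : scalarCurvature I x = _ :=
    Finset.sum_congr rfl fun i _ ↦ h.ricci_eq_of_soliton hsol (onb x i) (onb x i)
  rw [Finset.sum_add_distrib, ← Finset.mul_sum, ← Finset.mul_sum, sum_inner_onb_self hE,
    h.sum_eta_onb_sq] at key
  linarith

lemma IsTransSasakian.ricci_eq (h : IsTransSasakian I φ ξ η α β)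
    (hsol : IsEtaEinsteinSoliton I ξ η lam mu) (u v : TangentSpace I x) :
    ricci I x u v = (2 * lam + mu + β x) * inner ℝ u v + (β x - mu) * (η x u * η x v) := by
  rw [h.ricci_eq_of_soliton hsol, h.scalarCurvature_eq_of_soliton hE hsol]
  ring

/-! ### Consequences of the cyclic parallel condition -/

/-- The diagonal of the cyclic parallel condition, for the Ricci tensor of a three-dimensional
trans-Sasakian `η`-Einstein soliton. -/
lemma IsTransSasakian.mvfderiv_beta_identity (h : IsTransSasakian I φ ξ η α β)
    (hsol : IsEtaEinsteinSoliton I ξ η lam mu) (hcyc : HasCyclicParallelRicci I M)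
    (u : TangentSpace I x) :
    mvfderiv I β x u * (inner ℝ u u + η x u ^ 2)
      + 2 * (β x * (β x - mu)) * η x u * (inner ℝ u u - η x u ^ 2) = 0 := by
  have hc := h.toIsAlmostContactMetric
  have hu := contMDiffAt_extend_tangent (E := E) u
  have hX : MDiffAt (T% (extend E u)) x := mdifferentiableAt_extend ..
  have hξ := hc.mdiff_xi x
  have hb : MDiffAt β x := (h.smooth_beta x).mdifferentiableAt (by simp)
  -- With equal arguments the cyclic sum is three copies of `(∇_X S)(X, X)`, whence the final
  -- division by 3. The `∇_X X` terms cancel by metric compatibility.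
  have key := hcyc x _ _ _ hu hu hu
  have hXX := inner_mdiff hX hX
  have hXξ := inner_mdiff hX hξ
  have hf : MDiffAt (fun y ↦ 2 * lam + mu + β y) x := mdifferentiableAt_const.add hb
  have hg : MDiffAt (fun y ↦ β y - mu) x := hb.sub mdifferentiableAt_const
  have hdf : mvfderiv I (fun y ↦ 2 * lam + mu + β y) x = mvfderiv I β x := by
    rw [mvfderiv_fun_add mdifferentiableAt_const hb, mvfderiv_const, zero_add]
  have hdg : mvfderiv I (fun y ↦ β y - mu) x = mvfderiv I β x := by
    rw [mvfderiv_fun_sub hb mdifferentiableAt_const, mvfderiv_const, sub_zero]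
  have hm1 := leviCivita_metric hX hX hX
  have hm2 := leviCivita_metric hX hX hξ
  simp only [covDerivForm, h.ricci_eq hE hsol, hc.eta_eq] at key
  have hq : MDiffAt (fun y ↦ (inner ℝ (extend E u y) (ξ y) : ℝ) * inner ℝ (extend E u y) (ξ y)) x :=
    hXξ.mul hXξ
  have ha : MDiffAt (fun y ↦ (2 * lam + mu + β y) * inner ℝ (extend E u y) (extend E u y)) x :=
    hf.mul hXX
  have hb' : MDiffAt (fun y ↦ (β y - mu) *
      ((inner ℝ (extend E u y) (ξ y) : ℝ) * inner ℝ (extend E u y) (ξ y))) x := hg.mul hq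
  rw [mvfderiv_fun_add ha hb', mvfderiv_fun_mul hf hXX, mvfderiv_fun_mul hg hq, mvfderiv_fun_mul hXξ hXξ, hdf, hdg] at key
  simp only [add_apply, smul_apply, smul_eq_mul, hm1, hm2] at key
  have hn := h.leviCivita_xi u
  simp only [extend_apply_self] at key
  -- This is `(∇_u η)(u)`; the `α` term vanishes because `g(u, φu) = 0`.
  have e1 : inner ℝ u (leviCivita I M ξ x u) = β x * (inner ℝ u u - η x u ^ 2) := by
    have := hc.phi_skew x u u
    rw [hn, inner_add_right, inner_smul_right, inner_smul_right, inner_sub_right,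
      inner_smul_right, ← hc.eta_eq]
    linear_combination -α x / 2 * this
  rw [e1, real_inner_comm (leviCivita I M (extend E u) x u) u, ← hc.eta_eq] at key
  linear_combination key / 3

/-- At `ξ` the identity reads `2 dβ(ξ) = 0`; at `w ⊥ ξ` it reads `|w|² dβ(w) = 0`. -/
lemma IsTransSasakian.mvfderiv_beta_eq_zero (h : IsTransSasakian I φ ξ η α β)
    (hsol : IsEtaEinsteinSoliton I ξ η lam mu) (hcyc : HasCyclicParallelRicci I M) (x : M) :
    mvfderiv I β x = 0 := by
  have hc := h.toIsAlmostContactMetric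
  have hξ : mvfderiv I β x (ξ x) = 0 := by
    have := h.mvfderiv_beta_identity hE hsol hcyc (ξ x)
    rw [hc.inner_xi_xi, hc.eta_xi] at this
    linarith
  ext u
  set w := u - η x u • ξ x with hw
  have hηw : η x w = 0 := by simp [hw, hc.eta_xi]
  have key := h.mvfderiv_beta_identity hE hsol hcyc w
  have hdw : mvfderiv I β x w = 0 := by
    rw [hηw] at key
    obtain h0 | h0 : mvfderiv I β x w = 0 ∨ w = 0 := by simpa using key
    · exact h0
    · rw [h0, map_zero]
  have hu : u = w + η x u • ξ x := by rw [hw]; abel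
  rw [hu, map_add, map_smul, hdw, hξ]
  simp

lemma IsTransSasakian.beta_mul_eq_zero (h : IsTransSasakian I φ ξ η α β)
    (hsol : IsEtaEinsteinSoliton I ξ η lam mu) (hcyc : HasCyclicParallelRicci I M) (x : M) :
    β x * (β x - mu) = 0 := by
  have hc := h.toIsAlmostContactMetric
  obtain ⟨v, hv0, hv⟩ : ∃ v : TangentSpace I x, v ≠ 0 ∧ η x v = 0 := by
    have hdim : Module.finrank ℝ (TangentSpace I x) = 3 := hE
    have hr := LinearMap.finrank_range_add_finrank_ker (η x).toLinearMap
    have hle := (LinearMap.range (η x).toLinearMap).finrank_le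
    rw [Module.finrank_self] at hle
    have hpos : 0 < Module.finrank ℝ (LinearMap.ker (η x).toLinearMap) := by omega
    have := Module.finrank_pos_iff.1 hpos
    obtain ⟨⟨v, hv⟩, hv0⟩ := exists_ne (0 : LinearMap.ker (η x).toLinearMap)
    exact ⟨v, fun h0 ↦ hv0 (Subtype.ext h0), hv⟩
  -- The surviving term needs a vector neither orthogonal nor parallel to `ξ`; at `v + ξ` it equals
  -- `2β(β - μ)|v|²`.
  have key := h.mvfderiv_beta_identity hE hsol hcyc (v + ξ x)
  have hvξ : inner ℝ v (ξ x) = 0 := by rw [← hc.eta_eq, hv]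
  have hi : inner ℝ (v + ξ x) (v + ξ x) = inner ℝ v v + 1 := by
    rw [inner_add_left, inner_add_right, inner_add_right, real_inner_comm v (ξ x), hvξ,
      hc.inner_xi_xi]
    ring
  have hη : η x (v + ξ x) = 1 := by rw [map_add, hv, hc.eta_xi, zero_add]
  rw [h.mvfderiv_beta_eq_zero hE hsol hcyc, hi, hη] at key
  have hne : inner ℝ v v ≠ 0 := inner_self_ne_zero.2 hv0
  have : 2 * inner ℝ v v * (β x * (β x - mu)) = 0 := by
    simp only [zero_apply] at key
    linear_combination key
  exact (mul_eq_zero.1 this).resolve_left (mul_ne_zero two_ne_zero hne)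

end RiemGeom

end

theorem theorem4p6 {M : Type*} [TopologicalSpace M] [ChartedSpace (EuclideanSpace ℝ (Fin 3)) M]
    [IsManifold (𝓡 3) ∞ M]
    [RiemannianBundle (fun x : M ↦ TangentSpace (𝓡 3) x)]
    [IsContMDiffRiemannianBundle (𝓡 3) ∞ (EuclideanSpace ℝ (Fin 3))
      (fun x : M ↦ TangentSpace (𝓡 3) x)]
    (φ : Π x : M, TangentSpace (𝓡 3) x →L[ℝ] TangentSpace (𝓡 3) x)
    (ξ : Π x : M, TangentSpace (𝓡 3) x) (η : Π x : M, TangentSpace (𝓡 3) x →L[ℝ] ℝ)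
    (α β : M → ℝ) (lam mu : ℝ)
    (hM : RiemGeom.IsTransSasakian (𝓡 3) φ ξ η α β)
    (hsol : RiemGeom.IsEtaEinsteinSoliton (𝓡 3) ξ η lam mu)
    (hcyc : RiemGeom.HasCyclicParallelRicci (𝓡 3) M)
    (hβ : ∀ x : M, ∃ y ∈ connectedComponent x, β y ≠ 0) :
    (∀ x : M, β x = mu) ∧ RiemGeom.IsEinstein (𝓡 3) M ∧
      ∀ x : M, RiemGeom.scalarCurvature (𝓡 3) x = 6 * lam + 6 * β x := by
  have hE : Module.finrank ℝ (EuclideanSpace ℝ (Fin 3)) = 3 := finrank_euclideanSpace_fin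
  have : IsManifold (𝓡 3) 1 M := IsManifold.of_le (n := ∞) (by norm_cast)
  have hloc : IsLocallyConstant β := RiemGeom.isLocallyConstant_of_mvfderiv_eq_zero
    (fun x ↦ (hM.smooth_beta x).mdifferentiableAt (by simp))
    (hM.mvfderiv_beta_eq_zero hE hsol hcyc)
  have hmu (x : M) : β x = mu := by
    obtain ⟨y, hy, hy0⟩ := hβ x
    rw [hloc.apply_eq_of_isPreconnected isPreconnected_connectedComponent
      mem_connectedComponent hy]
    exact sub_eq_zero.1 ((mul_eq_zero.1 (hM.beta_mul_eq_zero hE hsol hcyc y)).resolve_left hy0)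
  -- The Einstein constant is the coefficient `2λ + μ + β` at `β = μ`.
  refine ⟨hmu, ⟨2 * lam + 2 * mu, fun x u v ↦ ?_⟩, fun x ↦ ?_⟩
  · rw [hM.ricci_eq hE hsol, hmu]
    ring
  · rw [hM.scalarCurvature_eq_of_soliton hE hsol, hmu]
    ring
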